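/- Let $N\ge 2$. For a bit string $\mathbf k\in\{0,1\}^N$ let $\overline{\mathbf k}$ be its bitwise complement, and let $\{\mathbf k_i,\overline{\mathbf k}_i\}$, $i=1,\dots,2^{N-1}$, be the $2^{N-1}$ complementary pairs of strings. An $N$-qubit GHZ-type basis consists of the conjugate pairs of states $$|\psi_i^+\rangle=\alpha_i|\mathbf k_i\rangle+\beta_i|\overline{\mathbf k}_i\rangle,\qquad |\psi_i^-\rangle=\beta_i|\mathbf k_i\rangle-\alpha_i|\overline{\mathbf k}_i\rangle,\qquad i=1,\dots,2^{N-1},$$ with real $\alpha_i\ge\beta_i$ and $\alpha_i^2+\beta_i^2=1$. The entanglement of $|\psi_i^\pm\rangle$ is $E_i=-\alpha_i^2\log_2\alpha_i^2-\beta_i^2\log_2\beta_i^2$ (with $0\log_2 0=0$), which is nonzero exactly when $\alpha_i\beta_i\ne0$. A spatially separated configuration is a distribution of the $N$ qubits among at least two parties, each of which holds at least one qubit (bipartitions are the case of two parties). A set $S$ of states is perfectly LOCC-distinguishable in a configuration if some protocol with finitely many rounds, in which the parties perform arbitrary quantum measurements on their own qubits (and ancillas) and broadcast the outcomes, identifies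 every state of $S$ with probability $1$. (a) Let $S$ be any set of states from an $N$-qubit GHZ-type basis, every state of $S$ being entangled ($E_i\neq0$ whenever $|\psi_i^+\rangle\in S$ or $|\psi_i^-\rangle\in S$). If there is a spatially separated configuration in which $S$ is perfectly LOCC-distinguishable, then $|S|\le 2^{N-1}$. (b) The bound is tight: for every $N$-qubit GHZ-type basis, any set consisting of exactly one state from each conjugate pair has $2^{N-1}$ elements and is perfectly LOCC-distinguishable in the configuration where all $N$ qubits are separated from each other, and hence in every spatially separated configuration. -/

import Mathlib

/-- The Hilbert space of `N` qubits, with coordinates in the computational basis, which is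
labelled by the bit strings of length `N`. -/
abbrev QubitSpace (N : ℕ) : Type := EuclideanSpace ℂ (Fin N → Bool)

/-- The computational basis vector `|k⟩`. -/
noncomputable def ket {N : ℕ} (k : Fin N → Bool) : QubitSpace N := EuclideanSpace.single k 1

/-- The bitwise complement of a bit string. -/
def flipBits {N : ℕ} (k : Fin N → Bool) : Fin N → Bool := fun q => !(k q)

/-- The data of an `N`-qubit GHZ-type basis: `2 ^ (N - 1)` complementary pairs of bit strings
`k i`, `flipBits (k i)` which together exhaust all strings of length `N`, and for each pair real
coefficients `α i ≥ β i` with `α i ^ 2 + β i ^ 2 = 1`. -/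
structure GHZBasis (N : ℕ) where
  k : Fin (2 ^ (N - 1)) → (Fin N → Bool)
  k_complete : ∀ x : Fin N → Bool, ∃! i, x = k i ∨ x = flipBits (k i)
  α : Fin (2 ^ (N - 1)) → ℝ
  β : Fin (2 ^ (N - 1)) → ℝ
  β_le_α : ∀ i, β i ≤ α i
  normalized : ∀ i, α i ^ 2 + β i ^ 2 = 1

namespace GHZBasis

/-- The states of the `i`-th conjugate pair: `state i true` is
`|ψᵢ⁺⟩ = αᵢ |kᵢ⟩ + βᵢ |k̄ᵢ⟩` and `state i false` is `|ψᵢ⁻⟩ = βᵢ |kᵢ⟩ - αᵢ |k̄ᵢ⟩`. -/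
noncomputable def state {N : ℕ} (G : GHZBasis N) (i : Fin (2 ^ (N - 1))) :
    Bool → QubitSpace N
  | true => (G.α i : ℂ) • ket (G.k i) + (G.β i : ℂ) • ket (flipBits (G.k i))
  | false => (G.β i : ℂ) • ket (G.k i) - (G.α i : ℂ) • ket (flipBits (G.k i))

/-- The set of all the states of the basis. -/
def states {N : ℕ} (G : GHZBasis N) : Set (QubitSpace N) :=
  {ψ | ∃ i s, ψ = G.state i s}

/-- The entanglement (in ebits) of each of the two states of the `i`-th conjugate pair:
`Eᵢ = - αᵢ² log₂ αᵢ² - βᵢ² log₂ βᵢ²`. -/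
noncomputable def entanglement {N : ℕ} (G : GHZBasis N) (i : Fin (2 ^ (N - 1))) : ℝ :=
  -(G.α i ^ 2) * Real.logb 2 (G.α i ^ 2) - G.β i ^ 2 * Real.logb 2 (G.β i ^ 2)

end GHZBasis

/-- A spatially separated configuration of `N` qubits: the qubits are distributed among at least
two parties, each of which holds at least one qubit. -/
structure SpatialConfig (N : ℕ) where
  parties : ℕ
  two_le_parties : 2 ≤ parties
  owner : Fin N → Fin parties
  owner_surjective : Function.Surjective owner

namespace SpatialConfig

/-- The configuration in which all the qubits are separated from each other. -/
def fullySeparated (N : ℕ) (hN : 2 ≤ N) : SpatialConfig N where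
  parties := N
  two_le_parties := hN
  owner := id
  owner_surjective := Function.surjective_id

/-- Labels of the computational basis of the subsystem held by the party `p`. -/
abbrev Local {N : ℕ} (C : SpatialConfig N) (p : Fin C.parties) : Type :=
  {q : Fin N // C.owner q = p} → Bool

/-- The coordinates of a state of `N` qubits, regarded as a vector of the tensor product of the
subsystems held by the parties. -/
def split {N : ℕ} (C : SpatialConfig N) (ψ : QubitSpace N) :
    ((p : Fin C.parties) → C.Local p) → ℂ :=
  fun x => ψ (fun q => x (C.owner q) ⟨q, rfl⟩)

end SpatialConfig

/-- A quantum measurement (instrument) on a system with a basis labelled by `d`: finitely many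
outcomes `o`, each with a Kraus operator into a finite-dimensional output space, which may vary
with the outcome, such that `∑ₒ Kₒ† Kₒ = 1`. Ancillas, and local randomness, are
covered, since the Kraus operators are arbitrary; a quantum operation with several Kraus operators
for an outcome is covered as well, by not making use of the extra information. -/
structure Instrument (d : Type) [Fintype d] [DecidableEq d] where
  outcomes : ℕ
  outDim : Fin outcomes → ℕ
  kraus : (o : Fin outcomes) → Matrix (Fin (outDim o)) d ℂ
  complete : ∑ o, (kraus o).conjTranspose * kraus o = 1

/-- LOCC protocols (with finitely many rounds) of the parties `p : P`, whose systems have bases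
labelled by `D p`, ending with a classical result in `R`. Either the parties stop and announce a
result, or there is a further round: each party performs a local instrument on its own system, all
the outcomes are broadcast, and the parties continue with a protocol which depends on all the
outcomes so far. Parties that stay idle in a round perform the one-outcome instrument given by
the identity, so that this includes the protocols in which the parties act one at a time. -/
inductive LOCCProtocol {P : Type} (R : Type) :
    (D : P → Type) → [∀ p, Fintype (D p)] → [∀ p, DecidableEq (D p)] → Type 1
  | announce {D : P → Type} [∀ p, Fintype (D p)] [∀ p, DecidableEq (D p)] (r : R) :
      LOCCProtocol R D
  | round {D : P → Type} [∀ p, Fintype (D p)] [∀ p, DecidableEq (D p)]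
      (I : (p : P) → Instrument (D p))
      (next : (o : (p : P) → Fin (I p).outcomes) →
        LOCCProtocol R (fun p => Fin ((I p).outDim (o p)))) :
      LOCCProtocol R D

open Classical in
/-- The probability that the protocol, run on the (normalized) joint state with coordinates `Ψ`,
ends with the result `r`. It is computed with unnormalized post-measurement states: if the outcomes
of a round are `o p`, then `⨂ₚ K p (o p)` is applied to the state. -/
noncomputable def LOCCProtocol.prob {P : Type} [Fintype P] [DecidableEq P] {R : Type} :
    {D : P → Type} → [∀ p, Fintype (D p)] → [∀ p, DecidableEq (D p)] →
      LOCCProtocol R D → (((p : P) → D p) → ℂ) → R → ℝ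
  | _, _, _, @LOCCProtocol.announce _ _ _ _ _ r', Ψ, r => if r' = r then ∑ x, ‖Ψ x‖ ^ 2 else 0
  | _, _, _, @LOCCProtocol.round _ _ _ _ _ I next, Ψ, r =>
      ∑ o : (p : P) → Fin (I p).outcomes,
        (next o).prob (fun x => ∑ y, (∏ p, (I p).kraus (o p) (x p) (y p)) * Ψ y) r

/-- The states of the set `S` are perfectly distinguishable by LOCC in the configuration `C`: some
LOCC protocol of the parties of `C`, run on any state of `S`, identifies that state
with certainty. -/
def PerfectlyLOCCDistinguishable {N : ℕ} (C : SpatialConfig N) (S : Set (QubitSpace N)) : Prop :=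
  ∃ T : LOCCProtocol (QubitSpace N) C.Local, ∀ ψ ∈ S, T.prob (C.split ψ) ψ = 1

/-! Upper bound: every LOCC protocol refines to a measurement by product functionals `φ t`
(`exists_product_measurement`). Let `k'` be `k` with the bits of one party complemented. Since `φ t`
factors over the parties, `φ t k * φ t k̄ = φ t k' * φ t k̄'`, so the cross product on a
complementary pair is shared with its partner pair `σ i`.

Suppose `S` contains both states of pair `i` and a state `ψ` of the partner pair `j`. An outcome
announcing `ψ` annihilates pair `i`, so its cross product vanishes; every other outcome annihilates
`ψ`. Comparing norms with `ψ` after a sign change (`eq_zero_of_diagonal_or_annihilates`), the latter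
outcomes vanish on all of pair `j`. In particular an outcome announcing `ψᵢ⁺` has zero cross product
on pair `i`; as it also annihilates the entangled `ψᵢ⁻`, it vanishes there, so `ψᵢ⁺` is never
announced. Hence `i` and `σ i` together contribute at most two states, and summing over `i` gives
the bound.

Tightness: states of different pairs have disjoint supports, so local computational-basis
measurements reveal the pair. -/

theorem sum_pi_prod_eq_prod_sum {P : Type} [Fintype P] [DecidableEq P] {E : P → Type} [∀ p, Fintype (E p)]
    (g : (p : P) → E p → ℂ) : ∑ x : (p : P) → E p, ∏ p, g p (x p) = ∏ p, ∑ e, g p e := by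
  rw [Finset.prod_univ_sum, Fintype.piFinset_univ]

/-- Applying the local instruments of a round to all the parties preserves the total norm. -/
theorem sum_norm_sq_kraus {P : Type} [Fintype P] [DecidableEq P] {D : P → Type}
    [∀ p, Fintype (D p)] [∀ p, DecidableEq (D p)] (I : (p : P) → Instrument (D p))
    (Ψ : ((p : P) → D p) → ℂ) :
    ∑ o : (p : P) → Fin (I p).outcomes, ∑ x : (p : P) → Fin ((I p).outDim (o p)),
      ‖∑ y, (∏ p, (I p).kraus (o p) (x p) (y p)) * Ψ y‖ ^ 2 = ∑ y, ‖Ψ y‖ ^ 2 := by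
  have hI : ∀ p (y z : D p), ∑ o, ∑ x, star ((I p).kraus o x y) * (I p).kraus o x z
      = if y = z then 1 else 0 := by
    intro p y z
    have h := congrFun (congrFun (I p).complete y) z
    rw [Matrix.sum_apply, Matrix.one_apply] at h
    simpa [Matrix.mul_apply] using h
  have hD : ∀ y z : (p : P) → D p,
      ∑ o : (p : P) → Fin (I p).outcomes, ∑ x : (p : P) → Fin ((I p).outDim (o p)),
        ∏ p, (star ((I p).kraus (o p) (x p) (y p)) * (I p).kraus (o p) (x p) (z p))
      = if y = z then 1 else 0 := by
    intro y z
    have h1 : ∀ o : (p : P) → Fin (I p).outcomes,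
        ∑ x : (p : P) → Fin ((I p).outDim (o p)),
          ∏ p, (star ((I p).kraus (o p) (x p) (y p)) * (I p).kraus (o p) (x p) (z p))
        = ∏ p, ∑ x, star ((I p).kraus (o p) x (y p)) * (I p).kraus (o p) x (z p) := fun o =>
      sum_pi_prod_eq_prod_sum
        fun p x => star ((I p).kraus (o p) x (y p)) * (I p).kraus (o p) x (z p)
    simp only [h1]
    rw [sum_pi_prod_eq_prod_sum fun p o =>
      ∑ x, star ((I p).kraus o x (y p)) * (I p).kraus o x (z p)]
    simp only [hI]
    simp [Finset.prod_ite_zero, funext_iff]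
  -- Squared norms are written as `star w * w`, so that the double sum over `y, z` can be moved
  -- outside and `hD` collapses it to the diagonal.
  have key : ∑ o : (p : P) → Fin (I p).outcomes, ∑ x : (p : P) → Fin ((I p).outDim (o p)),
      star (∑ y, (∏ p, (I p).kraus (o p) (x p) (y p)) * Ψ y)
        * (∑ y, (∏ p, (I p).kraus (o p) (x p) (y p)) * Ψ y) = ∑ y, star (Ψ y) * Ψ y := by
    calc _ = ∑ y, ∑ z, (star (Ψ y) * Ψ z) *
          ∑ o : (p : P) → Fin (I p).outcomes, ∑ x : (p : P) → Fin ((I p).outDim (o p)),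
          ∏ p, (star ((I p).kraus (o p) (x p) (y p)) * (I p).kraus (o p) (x p) (z p)) := by
          have h2 : ∀ (o : (p : P) → Fin (I p).outcomes)
              (x : (p : P) → Fin ((I p).outDim (o p))) (y z : (p : P) → D p),
              star ((∏ p, (I p).kraus (o p) (x p) (y p)) * Ψ y) *
                ((∏ p, (I p).kraus (o p) (x p) (z p)) * Ψ z) = (star (Ψ y) * Ψ z) *
                ∏ p, (star ((I p).kraus (o p) (x p) (y p)) * (I p).kraus (o p) (x p) (z p)) := by
            intro o x y z
            rw [Finset.prod_mul_distrib, star_mul', star_prod]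
            ring
          have h3 : ∀ (o : (p : P) → Fin (I p).outcomes)
              (x : (p : P) → Fin ((I p).outDim (o p))),
              star (∑ y, (∏ p, (I p).kraus (o p) (x p) (y p)) * Ψ y)
                * (∑ y, (∏ p, (I p).kraus (o p) (x p) (y p)) * Ψ y) =
              ∑ y, ∑ z, (star (Ψ y) * Ψ z) *
                ∏ p, (star ((I p).kraus (o p) (x p) (y p)) * (I p).kraus (o p) (x p) (z p)) := by
            intro o x
            rw [star_sum, Finset.sum_mul_sum]
            exact Finset.sum_congr rfl fun y _ => Finset.sum_congr rfl fun z _ => h2 o x y z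
          simp only [h3, Finset.mul_sum]
          rw [Finset.sum_congr rfl fun o _ => Finset.sum_comm, Finset.sum_comm]
          refine Finset.sum_congr rfl fun y _ => ?_
          rw [Finset.sum_congr rfl fun o _ => Finset.sum_comm, Finset.sum_comm]
      _ = _ := by
          simp_rw [hD]
          simp
  have h2 : ∀ w : ℂ, star w * w = ((‖w‖ ^ 2 : ℝ) : ℂ) := by
    intro w
    simpa using Complex.conj_mul' w
  simp_rw [h2] at key
  exact_mod_cast key

/-- An LOCC protocol acts as a measurement consisting of product vectors. -/
theorem LOCCProtocol.exists_product_measurement {P : Type} [Fintype P] [DecidableEq P] {R : Type}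
    {D : P → Type} [∀ p, Fintype (D p)] [∀ p, DecidableEq (D p)] (T : LOCCProtocol R D) :
    ∃ (ι : Type) (_ : Fintype ι) (f : ι → (p : P) → D p → ℂ) (l : ι → R),
      (∀ Ψ : ((p : P) → D p) → ℂ, ∑ t, ‖∑ y : (p : P) → D p, (∏ p, f t p (y p)) * Ψ y‖ ^ 2
        = ∑ y, ‖Ψ y‖ ^ 2) ∧
      ∀ Ψ r, T.prob Ψ r = ∑ t, open Classical in
        if l t = r then ‖∑ y : (p : P) → D p, (∏ p, f t p (y p)) * Ψ y‖ ^ 2 else 0 := by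
  induction T with
  | announce r =>
    rename_i D _ _
    have h : ∀ t y : (p : P) → D p, (∏ p, if y p = t p then (1 : ℂ) else 0)
        = if y = t then 1 else 0 := by
      intro t y
      simp [Finset.prod_ite_zero, funext_iff]
    -- A leaf is refined by a computational-basis measurement whose outcomes all carry the label
    -- `r`.
    refine ⟨(p : P) → D p, inferInstance, fun t p y => if y = t p then 1 else 0, fun _ => r,
      ?_, ?_⟩
    · intro Ψ
      simp [h]
    · intro Ψ r'
      simp only [LOCCProtocol.prob, h]
      split_ifs <;> simp
  | round I next ih =>
    rename_i D _ _
    choose ι hι f l hf hl using ih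
    have key : ∀ o (t : ι o) (Ψ : ((p : P) → D p) → ℂ),
        ∑ y : (p : P) → D p, (∏ p, ∑ x, f o t p x * (I p).kraus (o p) x (y p)) * Ψ y
        = ∑ x : (p : P) → Fin ((I p).outDim (o p)), (∏ p, f o t p (x p)) *
          ∑ y, (∏ p, (I p).kraus (o p) (x p) (y p)) * Ψ y := by
      intro o t Ψ
      simp_rw [← sum_pi_prod_eq_prod_sum, Finset.prod_mul_distrib, Finset.sum_mul, Finset.mul_sum]
      rw [Finset.sum_comm]
      exact Finset.sum_congr rfl fun x _ => Finset.sum_congr rfl fun y _ => mul_assoc _ _ _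
    -- Product functionals of the continuation, pulled back along the local Kraus operators, are
    -- again products.
    refine ⟨Σ o, ι o, inferInstance,
      fun t p y => ∑ x, f t.1 t.2 p x * (I p).kraus (t.1 p) x y, fun t => l t.1 t.2, ?_, ?_⟩
    · intro Ψ
      simp_rw [Fintype.sum_sigma, key, hf, sum_norm_sq_kraus]
    · intro Ψ r
      simp only [LOCCProtocol.prob]
      simp_rw [Fintype.sum_sigma, key, hl]

/-! ### Bit strings and partial complements -/

/-- Bits of a string with values in the subsystems of the parties. -/
def SpatialConfig.splitEquiv {N : ℕ} (C : SpatialConfig N) :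
    (Fin N → Bool) ≃ ((p : Fin C.parties) → C.Local p) where
  toFun k := fun _ q => k q.1
  invFun x := fun q => x (C.owner q) ⟨q, rfl⟩
  left_inv _ := rfl
  right_inv x := by
    funext p ⟨q, hq⟩
    subst hq
    rfl

theorem SpatialConfig.split_splitEquiv {N : ℕ} (C : SpatialConfig N) (ψ : QubitSpace N)
    (k : Fin N → Bool) : C.split ψ (C.splitEquiv k) = ψ k := rfl

theorem flipBits_flipBits {N : ℕ} (k : Fin N → Bool) : flipBits (flipBits k) = k := by
  funext q
  simp [flipBits]

theorem flipBits_ne {N : ℕ} (hN : 0 < N) (k : Fin N → Bool) : flipBits k ≠ k := fun h => by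
  simpa [flipBits] using congrFun h ⟨0, hN⟩

/-- The string obtained by complementing the bits in the set `A`. -/
def flipOn {N : ℕ} (A : Fin N → Prop) [DecidablePred A] (k : Fin N → Bool) : Fin N → Bool :=
  fun q => if A q then !(k q) else k q

theorem flipOn_flipOn {N : ℕ} (A : Fin N → Prop) [DecidablePred A] (k : Fin N → Bool) :
    flipOn A (flipOn A k) = k := by
  funext q
  by_cases h : A q <;> simp [flipOn, h]

theorem flipOn_flipBits {N : ℕ} (A : Fin N → Prop) [DecidablePred A] (k : Fin N → Bool) :
    flipOn A (flipBits k) = flipBits (flipOn A k) := by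
  funext q
  by_cases h : A q <;> simp [flipOn, flipBits, h]

/-! ### Coordinates and supports of the basis states -/

namespace GHZBasis

variable {N : ℕ} (G : GHZBasis N)

/-- The index of the complementary pair to which a bit string belongs. -/
noncomputable def index (x : Fin N → Bool) : Fin (2 ^ (N - 1)) := (G.k_complete x).choose

theorem index_spec (x : Fin N → Bool) :
    x = G.k (G.index x) ∨ x = flipBits (G.k (G.index x)) :=
  (G.k_complete x).choose_spec.1

theorem index_eq_iff {x : Fin N → Bool} {i : Fin (2 ^ (N - 1))} :
    G.index x = i ↔ x = G.k i ∨ x = flipBits (G.k i) := by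
  constructor
  · rintro rfl
    exact G.index_spec x
  · intro h
    exact ((G.k_complete x).choose_spec.2 i h).symm

theorem index_k (i : Fin (2 ^ (N - 1))) : G.index (G.k i) = i := G.index_eq_iff.2 (Or.inl rfl)

theorem index_flipBits (x : Fin N → Bool) : G.index (flipBits x) = G.index x := by
  rw [index_eq_iff]
  rcases G.index_spec x with h | h
  · exact Or.inr (congrArg flipBits h)
  · exact Or.inl ((congrArg flipBits h).trans (flipBits_flipBits _))

/-- The coefficient of a state of the basis at `|kᵢ⟩`. -/
def coeff (i : Fin (2 ^ (N - 1))) : Bool → ℝ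
  | true => G.α i
  | false => G.β i

/-- The coefficient of a state of the basis at `|k̄ᵢ⟩`. -/
def coeffFlip (i : Fin (2 ^ (N - 1))) : Bool → ℝ
  | true => G.β i
  | false => -G.α i

theorem coeff_sq_add (i : Fin (2 ^ (N - 1))) (s : Bool) :
    G.coeff i s ^ 2 + G.coeffFlip i s ^ 2 = 1 := by
  have := G.normalized i
  cases s <;> simp only [coeff, coeffFlip] <;> linarith

theorem state_apply (i : Fin (2 ^ (N - 1))) (s : Bool) (x : Fin N → Bool) :
    G.state i s x = (G.coeff i s : ℂ) * (if x = G.k i then 1 else 0)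
      + (G.coeffFlip i s : ℂ) * (if x = flipBits (G.k i) then 1 else 0) := by
  by_cases h : x = flipBits (G.k i) <;>
    cases s <;> simp [state, coeff, coeffFlip, ket, sub_eq_add_neg, h]

theorem sum_mul_state (i : Fin (2 ^ (N - 1))) (s : Bool) (φ : (Fin N → Bool) → ℂ) :
    ∑ x, φ x * G.state i s x
      = G.coeff i s * φ (G.k i) + G.coeffFlip i s * φ (flipBits (G.k i)) := by
  simp only [state_apply, mul_add, Finset.sum_add_distrib]
  simp [mul_comm]

theorem state_apply_eq_zero {i : Fin (2 ^ (N - 1))} (s : Bool) {x : Fin N → Bool}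
    (h : G.index x ≠ i) : G.state i s x = 0 := by
  rw [Ne, index_eq_iff, not_or] at h
  simp [state_apply, h]

theorem state_apply_k (hN : 0 < N) (i : Fin (2 ^ (N - 1))) (s : Bool) :
    G.state i s (G.k i) = G.coeff i s := by
  simp [state_apply, (flipBits_ne hN (G.k i)).symm]

theorem state_apply_flipBits (hN : 0 < N) (i : Fin (2 ^ (N - 1))) (s : Bool) :
    G.state i s (flipBits (G.k i)) = G.coeffFlip i s := by
  simp [state_apply, flipBits_ne hN (G.k i)]

/-- Arbitrary `a, b` are allowed because the norm comparison also uses the vector with one sign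
reversed, which need not be a basis state. -/
theorem sum_norm_sq_pair (hN : 0 < N) (i : Fin (2 ^ (N - 1))) (a b : ℝ) :
    ∑ x, ‖(a : ℂ) * (if x = G.k i then 1 else 0)
      + (b : ℂ) * (if x = flipBits (G.k i) then 1 else 0)‖ ^ 2 = a ^ 2 + b ^ 2 := by
  have h := flipBits_ne hN (G.k i)
  rw [Fintype.sum_eq_add _ _ h.symm]
  · simp [h, h.symm]
  · rintro x ⟨h1, h2⟩
    simp [h1, h2]

theorem sum_norm_sq_state (hN : 0 < N) (i : Fin (2 ^ (N - 1))) (s : Bool) :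
    ∑ x, ‖G.state i s x‖ ^ 2 = 1 := by
  simp only [state_apply, G.sum_norm_sq_pair hN, coeff_sq_add]

/-- A vector supported on two different pairs would be zero, against norm one. -/
theorem state_injective (hN : 0 < N) {i j : Fin (2 ^ (N - 1))} {s s' : Bool}
    (h : G.state i s = G.state j s') : i = j := by
  by_contra hij
  have h1 := G.sum_norm_sq_state hN i s
  rw [Finset.sum_eq_zero] at h1
  · exact zero_ne_one h1
  · intro x _
    by_cases hx : G.index x = i
    · rw [h, G.state_apply_eq_zero s' (by rwa [hx])]
      simp
    · rw [G.state_apply_eq_zero s hx]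
      simp

theorem state_true_ne_state_false (hN : 0 < N) (i : Fin (2 ^ (N - 1))) :
    G.state i true ≠ G.state i false := by
  intro h
  have h1 := congrArg (fun ψ : QubitSpace N => ψ (G.k i)) h
  have h2 := congrArg (fun ψ : QubitSpace N => ψ (flipBits (G.k i))) h
  simp only [state_apply_k G hN, state_apply_flipBits G hN, coeff, coeffFlip] at h1 h2
  norm_cast at h1 h2
  have := G.normalized i
  nlinarith

theorem α_ne_zero {i : Fin (2 ^ (N - 1))} (h : G.entanglement i ≠ 0) : G.α i ≠ 0 := by
  intro h0
  have := G.normalized i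
  have h1 : G.β i ^ 2 = 1 := by simpa [h0] using this
  exact h (by simp [entanglement, h0, h1])

theorem β_ne_zero {i : Fin (2 ^ (N - 1))} (h : G.entanglement i ≠ 0) : G.β i ≠ 0 := by
  intro h0
  have := G.normalized i
  have h1 : G.α i ^ 2 = 1 := by simpa [h0] using this
  exact h (by simp [entanglement, h0, h1])

theorem coeff_ne_zero {i : Fin (2 ^ (N - 1))} (h : G.entanglement i ≠ 0) (s : Bool) :
    G.coeff i s ≠ 0 := by
  cases s
  · exact G.β_ne_zero h
  · exact G.α_ne_zero h

theorem coeffFlip_ne_zero {i : Fin (2 ^ (N - 1))} (h : G.entanglement i ≠ 0) (s : Bool) :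
    G.coeffFlip i s ≠ 0 := by
  cases s
  · exact neg_ne_zero.2 (G.α_ne_zero h)
  · exact G.β_ne_zero h

/-- A vector annihilating both states of a conjugate pair vanishes on that pair of strings. -/
theorem eq_zero_of_annihilates_pair {i : Fin (2 ^ (N - 1))} {x y : ℂ}
    (h : ∀ s, (G.coeff i s : ℂ) * x + G.coeffFlip i s * y = 0) : x = 0 ∧ y = 0 := by
  have h1 := h true
  have h2 := h false
  simp only [coeff, coeffFlip] at h1 h2
  have h3 : (G.α i : ℂ) ^ 2 + (G.β i : ℂ) ^ 2 = 1 := by exact_mod_cast G.normalized i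
  push_cast at h2
  constructor
  · linear_combination (-x) * h3 + (G.α i : ℂ) * h1 + (G.β i : ℂ) * h2
  · linear_combination (-y) * h3 + (G.β i : ℂ) * h1 - (G.α i : ℂ) * h2

end GHZBasis

/-! ### The upper bound -/

/-- Suppose the pairs `(u t, v t)` have the Gram matrix of an orthonormal pair and real `c, d ≠ 0`
satisfy `c ^ 2 + d ^ 2 = 1`. If each `t` with `c * u t + d * v t ≠ 0` has `u t * v t = 0`, then
each `t` with `c * u t + d * v t = 0` has `u t = v t = 0`. -/
theorem eq_zero_of_diagonal_or_annihilates {ι : Type} [Fintype ι] {u v : ι → ℂ} {c d : ℝ}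
    (hc : c ≠ 0) (hd : d ≠ 0)
    (hsum : ∀ a b : ℝ, ∑ t, ‖(a : ℂ) * u t + b * v t‖ ^ 2 = a ^ 2 + b ^ 2)
    (huv : ∀ t, (c : ℂ) * u t + d * v t = 0 ∨ u t * v t = 0) {t : ι}
    (ht : (c : ℂ) * u t + d * v t = 0) : u t = 0 ∧ v t = 0 := by
  -- Reversing the sign of `d` never decreases a term, yet both totals are `c ^ 2 + d ^ 2`; so
  -- equality holds for every `t`.
  have hle : ∀ t ∈ Finset.univ, ‖(c : ℂ) * u t + d * v t‖ ^ 2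
      ≤ ‖(c : ℂ) * u t + (-d : ℝ) * v t‖ ^ 2 := by
    intro t _
    rcases huv t with h | h
    · rw [h]
      simp
    · rcases mul_eq_zero.1 h with h | h <;> simp [h]
  have heq := (Finset.sum_eq_sum_iff_of_le hle).1 (by rw [hsum, hsum, neg_sq]) t
    (Finset.mem_univ t)
  rw [ht] at heq
  have h2 : (c : ℂ) * u t + (-d : ℝ) * v t = 0 := by simpa using heq.symm
  push_cast at h2
  have hc' : (c : ℂ) ≠ 0 := by exact_mod_cast hc
  have hd' : (d : ℂ) ≠ 0 := by exact_mod_cast hd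
  constructor
  · have : (c : ℂ) * u t = 0 := by linear_combination (ht + h2) / 2
    exact (mul_eq_zero.1 this).resolve_left hc'
  · have : (d : ℂ) * v t = 0 := by linear_combination (ht - h2) / 2
    exact (mul_eq_zero.1 this).resolve_left hd'

/-- The measurement carried out by a protocol which distinguishes the states of `S`, in the
computational basis of the qubits. -/
theorem PerfectlyLOCCDistinguishable.exists_measurement {N : ℕ} {C : SpatialConfig N}
    {S : Set (QubitSpace N)} (h : PerfectlyLOCCDistinguishable C S) :
    ∃ (ι : Type) (_ : Fintype ι) (φ : ι → (Fin N → Bool) → ℂ) (l : ι → QubitSpace N),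
      (∀ Ψ : (Fin N → Bool) → ℂ, ∑ t, ‖∑ k, φ t k * Ψ k‖ ^ 2 = ∑ k, ‖Ψ k‖ ^ 2) ∧
      (∀ ψ ∈ S, ∑ t, (open Classical in if l t = ψ then ‖∑ k, φ t k * ψ k‖ ^ 2 else 0) = 1) ∧
      ∀ t p k, φ t k * φ t (flipBits k) = φ t (flipOn (fun q => C.owner q = p) k) *
        φ t (flipBits (flipOn (fun q => C.owner q = p) k)) := by
  obtain ⟨T, hT⟩ := h
  obtain ⟨ι, hι, f, l, hsum, hprob⟩ := T.exists_product_measurement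
  refine ⟨ι, hι, fun t k => ∏ p, f t p (C.splitEquiv k p), l, ?_, ?_, ?_⟩
  · intro Ψ
    have := hsum (fun x => Ψ (C.splitEquiv.symm x))
    simp_rw [← C.splitEquiv.sum_comp] at this
    simpa using this
  · intro ψ hψ
    have := hT ψ hψ
    rw [hprob] at this
    simp_rw [← C.splitEquiv.sum_comp, C.split_splitEquiv] at this
    exact this
  · intro t p k
    simp only [← Finset.prod_mul_distrib]
    refine Finset.prod_congr rfl fun p' _ => ?_
    -- For the party `p` the two factors are swapped; for the others they are unchanged.
    by_cases h : p' = p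
    · have h1 : C.splitEquiv (flipOn (fun q => C.owner q = p) k) p' = C.splitEquiv (flipBits k) p' := by
        funext ⟨q, hq⟩
        simp [SpatialConfig.splitEquiv, flipOn, flipBits, hq, h]
      have h2 : C.splitEquiv (flipBits (flipOn (fun q => C.owner q = p) k)) p'
          = C.splitEquiv k p' := by
        funext ⟨q, hq⟩
        simp [SpatialConfig.splitEquiv, flipOn, flipBits, hq, h]
      rw [h1, h2, mul_comm]
    · have h1 : C.splitEquiv (flipOn (fun q => C.owner q = p) k) p' = C.splitEquiv k p' := by
        funext ⟨q, hq⟩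
        simp [SpatialConfig.splitEquiv, flipOn, hq, h]
      have h2 : C.splitEquiv (flipBits (flipOn (fun q => C.owner q = p) k)) p'
          = C.splitEquiv (flipBits k) p' := by
        funext ⟨q, hq⟩
        simp [SpatialConfig.splitEquiv, flipOn, flipBits, hq, h]
      rw [h1, h2]

namespace GHZBasis

variable {N : ℕ} (G : GHZBasis N)

/-- If both states of a conjugate pair belong to a distinguishable set of entangled states, then no
state of the pair obtained by complementing the bits of one party does. -/
theorem state_notMem_of_pair_subset (hN : 0 < N) {C : SpatialConfig N} {S : Set (QubitSpace N)}
    (hS : ∀ i s, G.state i s ∈ S → G.entanglement i ≠ 0) (hC : PerfectlyLOCCDistinguishable C S)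
    (p : Fin C.parties) {i j : Fin (2 ^ (N - 1))} (hij : i ≠ j)
    (hj : G.index (flipOn (fun q => C.owner q = p) (G.k i)) = j)
    (hi : ∀ s, G.state i s ∈ S) (s : Bool) : G.state j s ∉ S := by
  intro hs
  obtain ⟨ι, _, φ, l, hsum, hprob, hφ⟩ := hC.exists_measurement
  -- Outcomes with the correct label already exhaust the norm, so all others have amplitude zero.
  have hzero : ∀ m s, G.state m s ∈ S → ∀ t, l t ≠ G.state m s →
      (G.coeff m s : ℂ) * φ t (G.k m) + G.coeffFlip m s * φ t (flipBits (G.k m)) = 0 := by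
    intro m s hm t ht
    have h1 := hprob _ hm
    rw [← G.sum_norm_sq_state hN m s, ← hsum] at h1
    have h2 := (Finset.sum_eq_sum_iff_of_le (fun t _ => by split_ifs <;> simp)).1 h1 t
      (Finset.mem_univ t)
    rw [if_neg ht, G.sum_mul_state] at h2
    simpa using h2.symm
  have hcross : ∀ t, φ t (G.k i) * φ t (flipBits (G.k i))
      = φ t (G.k j) * φ t (flipBits (G.k j)) := by
    intro t
    rw [hφ t p]
    rcases G.index_eq_iff.1 hj with h | h
    · rw [h]
    · rw [h, flipBits_flipBits, mul_comm]
  have hgram : ∀ a b : ℝ, ∑ t, ‖(a : ℂ) * φ t (G.k j) + b * φ t (flipBits (G.k j))‖ ^ 2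
      = a ^ 2 + b ^ 2 := by
    intro a b
    rw [← G.sum_norm_sq_pair hN j a b, ← hsum]
    refine Finset.sum_congr rfl fun t _ => ?_
    simp [mul_add, Finset.sum_add_distrib, mul_comm]
  have hdiag : ∀ t, (G.coeff j s : ℂ) * φ t (G.k j)
        + G.coeffFlip j s * φ t (flipBits (G.k j)) = 0
      ∨ φ t (G.k j) * φ t (flipBits (G.k j)) = 0 := by
    intro t
    by_cases ht : l t = G.state j s
    · right
      have := G.eq_zero_of_annihilates_pair fun s' => hzero i s' (hi s') t fun h =>
        hij (G.state_injective hN (h.symm.trans ht))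
      rw [← hcross, this.1, zero_mul]
    · exact Or.inl (hzero j s hs t ht)
  -- Such a `t` vanishes on pair `j`, so `hcross` kills one coordinate on pair `i`; annihilation of
  -- `ψᵢ⁻`, with both coefficients nonzero, kills the other.
  have hvanish : ∀ t, l t = G.state i true → ∑ k, φ t k * G.state i true k = 0 := by
    intro t ht
    have h1 := eq_zero_of_diagonal_or_annihilates (G.coeff_ne_zero (hS j s hs) s)
      (G.coeffFlip_ne_zero (hS j s hs) s) hgram hdiag
      (hzero j s hs t fun h => hij (G.state_injective hN (ht.symm.trans h)))
    have h2 := hzero i false (hi false) t fun h =>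
      G.state_true_ne_state_false hN i (ht.symm.trans h)
    have h3 := hcross t
    rw [h1.1, zero_mul] at h3
    have hc : (G.coeff i false : ℂ) ≠ 0 := by
      exact_mod_cast G.coeff_ne_zero (hS i true (hi true)) false
    have hd : (G.coeffFlip i false : ℂ) ≠ 0 := by
      exact_mod_cast G.coeffFlip_ne_zero (hS i true (hi true)) false
    rw [G.sum_mul_state]
    rcases mul_eq_zero.1 h3 with h | h
    · simp only [h, mul_zero, zero_add, mul_eq_zero, hd, false_or] at h2
      simp [h, h2]
    · simp only [h, mul_zero, add_zero, mul_eq_zero, hc, false_or] at h2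
      simp [h, h2]
  have h1 := hprob _ (hi true)
  rw [Finset.sum_eq_zero] at h1
  · exact zero_ne_one h1
  · intro t _
    split_ifs with ht
    · rw [hvanish t ht]
      simp
    · rfl

theorem ncard_le_of_perfectlyLOCCDistinguishable (hN : 0 < N) {C : SpatialConfig N}
    {S : Set (QubitSpace N)} (hGS : S ⊆ G.states)
    (hS : ∀ i s, G.state i s ∈ S → G.entanglement i ≠ 0)
    (hC : PerfectlyLOCCDistinguishable C S) : S.ncard ≤ 2 ^ (N - 1) := by
  classical
  have hp := C.two_le_parties
  let p : Fin C.parties := ⟨0, by omega⟩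
  let p' : Fin C.parties := ⟨1, by omega⟩
  have hpp : p' ≠ p := by simp [p, p', Fin.ext_iff]
  obtain ⟨q, hq⟩ := C.owner_surjective p
  obtain ⟨q', hq'⟩ := C.owner_surjective p'
  let A : Fin N → Prop := fun q => C.owner q = p
  let σ : Fin (2 ^ (N - 1)) → Fin (2 ^ (N - 1)) := fun i => G.index (flipOn A (G.k i))
  have hσσ : Function.Involutive σ := by
    intro i
    change G.index (flipOn A (G.k (G.index (flipOn A (G.k i))))) = i
    rcases G.index_spec (flipOn A (G.k i)) with h | h
    · rw [← h, flipOn_flipOn, index_k]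
    · rw [← flipBits_flipBits (G.k (G.index (flipOn A (G.k i)))), ← h, flipOn_flipBits,
        flipOn_flipOn, index_flipBits, index_k]
  -- The qubit `q` of `p` is complemented and `q'` of `p'` is not, so the result is neither `kᵢ` nor
  -- its complement.
  have hσ : ∀ i, i ≠ σ i := by
    intro i h
    rcases G.index_eq_iff.1 h.symm with h | h
    · have := congrFun h q
      simp [flipOn, A, hq] at this
    · have := congrFun h q'
      simp [flipOn, flipBits, A, hq', hpp] at this
  let n : Fin (2 ^ (N - 1)) → ℕ := fun i => (Finset.univ.filter fun s => G.state i s ∈ S).card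
  have hn : ∀ i, n i + n (σ i) ≤ 2 := by
    intro i
    have hle : ∀ i, n i ≤ 2 := fun i => (Finset.card_le_univ _).trans (by simp)
    have hfull : ∀ i, n i = 2 → n (σ i) = 0 := by
      intro i hi
      have h1 : (Finset.univ.filter fun s => G.state i s ∈ S) = Finset.univ :=
        (Finset.card_eq_iff_eq_univ _).1 (hi.trans (by simp))
      have h2 : ∀ s, G.state i s ∈ S := by simpa [Finset.filter_eq_self] using h1
      have h3 := G.state_notMem_of_pair_subset hN hS hC p (hσ i) rfl h2
      simpa [n] using h3
    have h1 := hle i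
    have h2 := hle (σ i)
    have h3 := hfull i
    have h4 := hfull (σ i)
    rw [hσσ i] at h4
    omega
  have hcard : S.ncard ≤ ∑ i, n i := by
    have hsub : S ⊆ ((Finset.univ.biUnion fun i =>
        (Finset.univ.filter fun s => G.state i s ∈ S).image (G.state i) :
          Finset (QubitSpace N)) : Set (QubitSpace N)) := by
      intro ψ hψ
      obtain ⟨i, s, rfl⟩ := hGS hψ
      simp only [Finset.coe_biUnion, Set.mem_iUnion, Finset.mem_coe, Finset.mem_image]
      exact ⟨i, Finset.mem_univ i, s, by simpa using hψ, rfl⟩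
    calc S.ncard ≤ _ := Set.ncard_le_ncard hsub (Finset.finite_toSet _)
      _ = _ := Set.ncard_coe_finset _
      _ ≤ _ := Finset.card_biUnion_le
      _ ≤ _ := Finset.sum_le_sum fun i _ => Finset.card_image_le
  -- Summing `hn` over all `i` counts each state twice.
  have hsum : ∑ i, n (σ i) = ∑ i, n i := Equiv.sum_comp (hσσ.toPerm σ) n
  have htot : ∑ i, (n i + n (σ i)) ≤ ∑ _i : Fin (2 ^ (N - 1)), 2 :=
    Finset.sum_le_sum fun i _ => hn i
  rw [Finset.sum_add_distrib, hsum] at htot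
  simp only [Finset.sum_const, Finset.card_univ, Fintype.card_fin, smul_eq_mul] at htot
  omega

end GHZBasis

/-! ### Tightness -/

/-- The measurement in the computational basis. -/
noncomputable def Instrument.computational (d : Type) [Fintype d] [DecidableEq d] :
    Instrument d where
  outcomes := Fintype.card d
  outDim _ := 1
  kraus o := Matrix.of fun _ y => if y = (Fintype.equivFin d).symm o then 1 else 0
  complete := by
    ext y z
    rw [Matrix.sum_apply, ← (Fintype.equivFin d).sum_comp, Matrix.one_apply]
    simp [Matrix.mul_apply]

/-- Measuring everything in the computational basis and announcing a function of the outcome. -/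
noncomputable def LOCCProtocol.computational {P : Type} {R : Type} (D : P → Type)
    [∀ p, Fintype (D p)] [∀ p, DecidableEq (D p)] (r : ((p : P) → D p) → R) :
    LOCCProtocol R D :=
  .round (fun p => Instrument.computational (D p))
    fun o => .announce (r fun p => (Fintype.equivFin (D p)).symm (o p))

open Classical in
theorem LOCCProtocol.prob_computational {P : Type} [Fintype P] [DecidableEq P] {R : Type}
    (D : P → Type) [∀ p, Fintype (D p)] [∀ p, DecidableEq (D p)] (r : ((p : P) → D p) → R)
    (Ψ : ((p : P) → D p) → ℂ) (r' : R) :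
    (LOCCProtocol.computational D r).prob Ψ r' = ∑ y, if r y = r' then ‖Ψ y‖ ^ 2 else 0 := by
  have h : ∀ t y : (p : P) → D p, (∏ p, if y p = t p then (1 : ℂ) else 0)
      = if y = t then 1 else 0 := by
    intro t y
    simp [Finset.prod_ite_zero, funext_iff]
  rw [← (Equiv.piCongrRight fun p => (Fintype.equivFin (D p)).symm).sum_comp]
  simp only [computational, prob]
  refine Finset.sum_congr rfl fun o _ => if_congr Iff.rfl ?_ rfl
  have h2 : ∀ y : (p : P) → D p, (∏ p, if y p = (Fintype.equivFin (D p)).symm (o p)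
      then (1 : ℂ) else 0)
      = if y = (fun p => (Fintype.equivFin (D p)).symm (o p)) then 1 else 0 :=
    h fun p => (Fintype.equivFin (D p)).symm (o p)
  have : ∀ p, Unique (Fin ((Instrument.computational (D p)).outDim (o p))) := fun _ =>
    inferInstanceAs (Unique (Fin 1))
  -- Every output space is one-dimensional, so the final norm is a single term, the amplitude at the
  -- observed string.
  rw [Fintype.sum_unique]
  simp only [Instrument.computational, Matrix.of_apply, h2]
  simp
  rfl

namespace GHZBasis

variable {N : ℕ} (G : GHZBasis N)

/-- The observed string lies in the support of the given state, hence determines its pair, and `s`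
then determines the state. -/
theorem perfectlyLOCCDistinguishable_range (hN : 0 < N) (s : Fin (2 ^ (N - 1)) → Bool)
    (C : SpatialConfig N) :
    PerfectlyLOCCDistinguishable C (Set.range fun i => G.state i (s i)) := by
  classical
  refine ⟨.computational C.Local fun x =>
    G.state (G.index (C.splitEquiv.symm x)) (s (G.index (C.splitEquiv.symm x))), ?_⟩
  rintro _ ⟨i, rfl⟩
  rw [LOCCProtocol.prob_computational, ← C.splitEquiv.sum_comp,
    ← G.sum_norm_sq_state hN i (s i)]
  refine Finset.sum_congr rfl fun x _ => ?_
  simp only [Equiv.symm_apply_apply, C.split_splitEquiv]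
  by_cases hx : G.index x = i
  · simp [hx]
  · rw [G.state_apply_eq_zero _ hx]
    simp

theorem ncard_range_state (hN : 0 < N) (s : Fin (2 ^ (N - 1)) → Bool) :
    (Set.range fun i => G.state i (s i)).ncard = 2 ^ (N - 1) := by
  rw [← Set.image_univ, Set.ncard_image_of_injective _ fun i j h => G.state_injective hN h,
    Set.ncard_univ, Nat.card_fin]

end GHZBasis

theorem theorem1 (N : ℕ) (hN : 2 ≤ N) (G : GHZBasis N) :
    (∀ S : Set (QubitSpace N), S ⊆ G.states →
      (∀ i s, G.state i s ∈ S → G.entanglement i ≠ 0) →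
      (∃ C : SpatialConfig N, PerfectlyLOCCDistinguishable C S) →
      S.ncard ≤ 2 ^ (N - 1)) ∧
    (∀ s : Fin (2 ^ (N - 1)) → Bool,
      (Set.range fun i => G.state i (s i)).ncard = 2 ^ (N - 1) ∧
      PerfectlyLOCCDistinguishable (SpatialConfig.fullySeparated N hN)
        (Set.range fun i => G.state i (s i)) ∧
      ∀ C : SpatialConfig N,
        PerfectlyLOCCDistinguishable C (Set.range fun i => G.state i (s i))) := by
  have hN0 : 0 < N := by omega
  refine ⟨fun S hGS hS ⟨C, hC⟩ =>
    G.ncard_le_of_perfectlyLOCCDistinguishable hN0 hGS hS hC, fun s => ⟨?_, ?_, ?_⟩⟩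
  · exact G.ncard_range_state hN0 s
  · exact G.perfectlyLOCCDistinguishable_range hN0 s _
  · exact G.perfectlyLOCCDistinguishable_range hN0 s
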